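/- Let $n\ge 2$, let $F$ be a field, $S=F[x_1,\dots,x_n]$ and $S'=F[x_2,\dots,x_n]$, and order monomials of the same degree lexicographically with $x_1>x_2>\dots>x_n$. A set $L$ of monomials, all of the same degree $t$, is called lexsegment if $m\in L$, $\deg v=t$ and $v>m$ imply $v\in L$. For a set $K$ of monomials in $S$ let $S_1\cdot K$ be the set of all monomials $x_jm$ with $1\le j\le n$ and $m\in K$; for $S'$ the set $S'_1\cdot K$ is defined in the same way with the variables $x_2,\dots,x_n$. A set $M$ of monomials of the same degree $t$ in $S$ is called Gotzmann (in $S$) if $|S_1\cdot L|=|S_1\cdot M|$, where $L$ is the lexsegment set of $|M|$ monomials of degree $t$ in $S$; Gotzmann sets in $S'$ are defined in the same way. Finally, $d^{<n-2>}$ denotes the size of $S'_1\cdot L$, where $L$ is a lexsegment set of $d$ monomials of the same degree in $S'$; this number does not depend on the degree of $L$. Theorem. Let $t\ge 0$ and let $M$ be a Gotzmann set of monomials of degree $t$ in $S$. For a set $K$ of monomials let $K^i$ be the set of the monomials in $K$ that are divisible by $x_1^i$ but not by $x_1^{i+1}$ (so $K^i=\emptyset$ for $i<0$), and put $d_i=|M^i|$.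 Then for every integer $0\le i\le t+1$ the following hold. 1. $|(S_1\cdot M)^i|=\max\{d_i^{<n-2>},\,d_{i-1}\}$. 2. If $d_i^{<n-2>}\ge d_{i-1}$, then the set $M^i/x_1^i=\{m\in S' \text{ a monomial}: m\,x_1^i\in M^i\}$ is a Gotzmann set in $S'$. 3. If $d_i^{<n-2>}<d_{i-1}$, then $(d_i+1)^{<n-2>}>d_{i-1}-1$ or $d_i+1>d_{i+1}^{<n-2>}$ (or both). -/

import Mathlib

open Finset

/-- Monomials in the variables indexed by `σ` are represented by their exponent vectors
`σ →₀ ℕ`; this is the finite set of all monomials of degree `t`. -/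
def monomialsOfDegree (σ : Type*) [Fintype σ] [DecidableEq σ] (t : ℕ) : Finset (σ →₀ ℕ) :=
  (univ : Finset σ).finsuppAntidiag t

/-- `S₁ · M`: all monomials `x_j * m` with `x_j` a variable and `m ∈ M`. -/
noncomputable def mulVars {σ : Type*} [Fintype σ] [DecidableEq σ] (M : Finset (σ →₀ ℕ)) : Finset (σ →₀ ℕ) :=
  M.biUnion fun m => univ.image fun j => m + Finsupp.single j 1

/-- A set of monomials is lexsegment if with `m` it contains every monomial `v` of the same degree
which is larger than `m` in the lexicographic order (`x_1 > x_2 > ⋯`, so that `toLex m < toLex v`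
means `m j < v j` at the first index `j` at which `m` and `v` differ). -/
def IsLexsegment {σ : Type*} [LinearOrder σ] (M : Finset (σ →₀ ℕ)) : Prop :=
  ∀ m ∈ M, ∀ v : σ →₀ ℕ, v.degree = m.degree → toLex m < toLex v → v ∈ M

/-- The set of the `d` lexicographically largest monomials of degree `t` (all monomials of degree
`t` if there are fewer than `d` of them). -/
def lexSegment (σ : Type*) [Fintype σ] [LinearOrder σ] (t d : ℕ) : Finset (σ →₀ ℕ) :=
  (monomialsOfDegree σ t).filter fun v =>
    ((monomialsOfDegree σ t).filter fun w => toLex v < toLex w).card < d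

/-- A finite set `M` of monomials, all of the same degree `t`, is Gotzmann if
`|S₁ · lex(M)| = |S₁ · M|`, with `lex(M)` the lexsegment set of `|M|` monomials of degree `t`. -/
def IsGotzmann {σ : Type*} [Fintype σ] [LinearOrder σ] (M : Finset (σ →₀ ℕ)) : Prop :=
  ∃ t : ℕ, (∀ m ∈ M, m.degree = t) ∧
    (mulVars (lexSegment σ t M.card)).card = (mulVars M).card

/-- The number `d^{<k>}`: the size of `S₁ · L` for a homogeneous lexsegment set `L` of size `d` in
`k + 1` variables. The size does not depend on the degree of `L` (see `card_mulVars_eq_lexGrowth`),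
and the degree `d` is one in which such an `L` exists (for `k = 0` only `d ≤ 1` is meaningful). -/
noncomputable def lexGrowth (k d : ℕ) : ℕ := (mulVars (lexSegment (Fin (k + 1)) d d)).card

/-- `M^i`: the monomials in `M` that are divisible by `x_1^i` but not by `x_1^(i+1)`. The first
variable has index `0`. The index is an integer, and `M^i = ∅` for negative `i`. -/
noncomputable def component {n : ℕ} (M : Finset (Fin (n + 1) →₀ ℕ)) (i : ℤ) : Finset (Fin (n + 1) →₀ ℕ) :=
  M.filter fun m => (m 0 : ℤ) = i

/-- The set of the monomials `m` in `x_2, …, x_n` such that `m * x_1^i ∈ M^i`: the first exponent is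
removed from the monomials in `M^i`. -/
noncomputable def componentQuot {n : ℕ} (M : Finset (Fin (n + 1) →₀ ℕ)) (i : ℤ) : Finset (Fin n →₀ ℕ) :=
  (component M i).image Finsupp.tail

theorem mem_monomialsOfDegree {σ : Type*} [Fintype σ] [DecidableEq σ] {t : ℕ} {m : σ →₀ ℕ} :
    m ∈ monomialsOfDegree σ t ↔ m.degree = t := by
  simp [monomialsOfDegree, Finset.mem_finsuppAntidiag, Finsupp.degree_eq_sum]

theorem mem_mulVars {σ : Type*} [Fintype σ] [DecidableEq σ] {M : Finset (σ →₀ ℕ)} {v : σ →₀ ℕ} :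
    v ∈ mulVars M ↔ ∃ m ∈ M, ∃ j, m + Finsupp.single j 1 = v := by
  simp [mulVars]

theorem mem_componentQuot {n : ℕ} {M : Finset (Fin (n + 1) →₀ ℕ)} {i : ℕ} {m : Fin n →₀ ℕ} :
    m ∈ componentQuot M i ↔ Finsupp.cons i m ∈ M := by
  simp only [componentQuot, component, mem_image, mem_filter, Nat.cast_inj]
  constructor
  · rintro ⟨a, ⟨ha, h0⟩, rfl⟩
    rw [← h0, Finsupp.cons_tail]; exact ha
  · intro h
    exact ⟨_, ⟨h, Finsupp.cons_zero _ _⟩, Finsupp.tail_cons _ _⟩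

/-- A homogeneous lexsegment set is determined by its degree and its size. -/
theorem IsLexsegment.eq_lexSegment {σ : Type*} [Fintype σ] [LinearOrder σ] {t : ℕ}
    {L : Finset (σ →₀ ℕ)} (hL : IsLexsegment L) (ht : ∀ m ∈ L, m.degree = t) :
    L = lexSegment σ t L.card := by
  ext v
  simp only [lexSegment, mem_filter, mem_monomialsOfDegree]
  constructor
  · intro hv
    refine ⟨ht v hv, Finset.card_lt_card ⟨?_, ?_⟩⟩
    · intro w hw
      simp only [mem_filter, mem_monomialsOfDegree] at hw
      exact hL v hv w (by rw [hw.1, ht v hv]) hw.2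
    · intro h
      have := h hv
      simp at this
  · rintro ⟨hd, hc⟩
    by_contra hv
    refine absurd hc (not_lt.2 (Finset.card_le_card ?_))
    intro w hw
    simp only [mem_filter, mem_monomialsOfDegree]
    refine ⟨ht w hw, ?_⟩
    by_contra hlt
    rcases lt_or_eq_of_le (not_lt.1 hlt) with h | h
    · exact hv (hL w hw v (by rw [hd, ht w hw]) h)
    · exact hv (by rw [← toLex.injective h]; exact hw)

theorem isLexsegment_lexSegment (σ : Type*) [Fintype σ] [LinearOrder σ] (t d : ℕ) :
    IsLexsegment (lexSegment σ t d) := by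
  intro m hm v hv hlt
  simp only [lexSegment, mem_filter, mem_monomialsOfDegree] at hm ⊢
  refine ⟨hv.trans hm.1, lt_of_le_of_lt (Finset.card_le_card ?_) hm.2⟩
  intro w hw
  simp only [mem_filter, mem_monomialsOfDegree] at hw ⊢
  exact ⟨hw.1, hlt.trans hw.2⟩

theorem degree_of_mem_lexSegment {σ : Type*} [Fintype σ] [LinearOrder σ] {t d : ℕ}
    {m : σ →₀ ℕ} (hm : m ∈ lexSegment σ t d) : m.degree = t :=
  mem_monomialsOfDegree.1 (mem_filter.1 hm).1

/-- There is a lexsegment set of each possible size. -/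
theorem card_lexSegment {σ : Type*} [Fintype σ] [LinearOrder σ] {t d : ℕ}
    (hd : d ≤ (monomialsOfDegree σ t).card) : (lexSegment σ t d).card = d := by
  classical
  set A := monomialsOfDegree σ t with hA
  let r : (σ →₀ ℕ) → ℕ := fun v => (A.filter fun w => toLex v < toLex w).card
  have hanti : ∀ v ∈ A, ∀ w ∈ A, toLex v < toLex w → r w < r v := by
    intro v _ w hw h
    refine Finset.card_lt_card ⟨?_, ?_⟩
    · intro u hu
      simp only [mem_filter] at hu ⊢
      exact ⟨hu.1, h.trans hu.2⟩
    · intro hs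
      have := hs (mem_filter.2 ⟨hw, h⟩)
      simp at this
  have hinj : Set.InjOn r A := by
    intro v hv w hw h
    rcases lt_trichotomy (toLex v) (toLex w) with h1 | h1 | h1
    · exact absurd h (hanti v hv w hw h1).ne'
    · exact toLex.injective h1
    · exact absurd h (hanti w hw v hv h1).ne
  have hlt : ∀ v ∈ A, r v < A.card := by
    intro v hv
    refine Finset.card_lt_card ⟨filter_subset _ _, fun hs => ?_⟩
    have := hs hv
    simp at this
  have himg : A.image r = range A.card := by
    refine Finset.eq_of_subset_of_card_le ?_ ?_
    · intro x hx
      obtain ⟨v, hv, rfl⟩ := mem_image.1 hx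
      exact mem_range.2 (hlt v hv)
    · rw [card_range, Finset.card_image_of_injOn hinj]
  have h2 : (lexSegment σ t d).image r = range d := by
    ext x
    simp only [mem_image, mem_range, lexSegment, mem_filter]
    constructor
    · rintro ⟨v, ⟨_, hv⟩, rfl⟩
      exact hv
    · intro hx
      have : x ∈ A.image r := by rw [himg]; exact mem_range.2 (hx.trans_le hd)
      obtain ⟨v, hv, rfl⟩ := mem_image.1 this
      exact ⟨v, ⟨hv, hx⟩, rfl⟩
  have hc : ((lexSegment σ t d).image r).card = (lexSegment σ t d).card := by
    refine Finset.card_image_of_injOn ?_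
    intro v hv w hw h
    have hv' : v ∈ lexSegment σ t d := hv
    have hw' : w ∈ lexSegment σ t d := hw
    exact hinj (mem_monomialsOfDegree.2 (degree_of_mem_lexSegment hv'))
      (mem_monomialsOfDegree.2 (degree_of_mem_lexSegment hw')) h
  rw [← hc, h2, card_range]

theorem lexSegment_shift {k s c d : ℕ} (hd : d ≤ (monomialsOfDegree (Fin (k + 1)) s).card) :
    (lexSegment (Fin (k + 1)) s d).image (fun m => m + Finsupp.single 0 c) =
      lexSegment (Fin (k + 1)) (s + c) d := by
  have hc : ((lexSegment (Fin (k + 1)) s d).image (fun m => m + Finsupp.single 0 c)).card = d := by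
    rw [Finset.card_image_of_injective _ (add_left_injective _), card_lexSegment hd]
  have key : IsLexsegment
      ((lexSegment (Fin (k + 1)) s d).image (fun m => m + Finsupp.single 0 c)) := by
    intro m hm v hv hlt
    obtain ⟨u, hu, rfl⟩ := mem_image.1 hm
    have h0 : c ≤ v 0 := by
      obtain ⟨j, hj1, hj2⟩ := Finsupp.Lex.lt_iff.1 hlt
      rcases Fin.eq_zero_or_eq_succ j with rfl | ⟨j', rfl⟩
      · simp at hj2; omega
      · have := hj1 0 (Fin.succ_pos _)
        simp at this; omega
    have hle : Finsupp.single 0 c ≤ v := by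
      rw [Finsupp.single_le_iff]; exact h0
    obtain ⟨w, rfl⟩ : ∃ w, v = w + Finsupp.single 0 c := ⟨_, (tsub_add_cancel_of_le hle).symm⟩
    refine mem_image.2 ⟨w, isLexsegment_lexSegment _ _ _ u hu w ?_ ?_, rfl⟩
    · simpa using hv
    · exact lt_of_add_lt_add_right (a := toLex (Finsupp.single 0 c)) hlt
  have := key.eq_lexSegment (t := s + c) (by
    intro m hm
    obtain ⟨u, hu, rfl⟩ := mem_image.1 hm
    simp [degree_of_mem_lexSegment hu])
  rw [hc] at this
  exact this

theorem card_mulVars_lexSegment_shift {k s c d : ℕ}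
    (hd : d ≤ (monomialsOfDegree (Fin (k + 1)) s).card) :
    (mulVars (lexSegment (Fin (k + 1)) (s + c) d)).card =
      (mulVars (lexSegment (Fin (k + 1)) s d)).card := by
  rw [← lexSegment_shift hd,
    ← Finset.card_image_of_injective (mulVars (lexSegment (Fin (k + 1)) s d))
      (add_left_injective (Finsupp.single 0 c))]
  congr 1
  ext v
  simp only [mem_mulVars, mem_image]
  constructor
  · rintro ⟨_, ⟨m, hm, rfl⟩, j, rfl⟩
    exact ⟨_, ⟨m, hm, j, rfl⟩, add_right_comm _ _ _⟩
  · rintro ⟨_, ⟨m, hm, j, rfl⟩, rfl⟩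
    exact ⟨_, ⟨m, hm, rfl⟩, j, add_right_comm _ _ _⟩

/-- `lexGrowth` is well defined: every homogeneous lexsegment set `L` in `k + 1` variables, of
whichever degree, satisfies `|S₁ · L| = |L|^{<k>}`. -/
theorem card_mulVars_eq_lexGrowth {k t : ℕ} {L : Finset (Fin (k + 1) →₀ ℕ)}
    (hL : IsLexsegment L) (ht : ∀ m ∈ L, m.degree = t) :
    (mulVars L).card = lexGrowth k L.card := by
  have hsub : L.card ≤ (monomialsOfDegree (Fin (k + 1)) t).card :=
    Finset.card_le_card fun m hm => mem_monomialsOfDegree.2 (ht m hm)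
  have hLe := hL.eq_lexSegment ht
  generalize L.card = d at *
  subst hLe
  unfold lexGrowth
  rcases le_total t d with h | h
  · obtain ⟨c, rfl⟩ := Nat.exists_eq_add_of_le h
    exact (card_mulVars_lexSegment_shift hsub).symm
  · obtain ⟨c, rfl⟩ := Nat.exists_eq_add_of_le h
    refine card_mulVars_lexSegment_shift ?_
    rcases Nat.eq_zero_or_pos k with rfl | hk
    · refine hsub.trans (Finset.card_le_card_of_injOn (fun _ => Finsupp.single 0 d) ?_ ?_)
      · intro m _
        exact mem_monomialsOfDegree.2 (by simp)
      · intro a ha b hb _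
        have ha' := mem_monomialsOfDegree.1 ha
        have hb' := mem_monomialsOfDegree.1 hb
        ext j
        simp [Finsupp.degree_eq_sum] at ha' hb'
        have hj : j = 0 := Fin.ext (by have := j.isLt; simp)
        rw [hj, ha', hb']
    · have : (range d).card ≤ (monomialsOfDegree (Fin (k + 1)) d).card := by
        refine Finset.card_le_card_of_injOn
          (fun j => Finsupp.single 0 j + Finsupp.single (Fin.last k) (d - j)) ?_ ?_
        · intro j hj
          have := mem_range.1 (Finset.mem_coe.1 hj)
          refine mem_monomialsOfDegree.2 ?_
          simp only [map_add, Finsupp.degree_single]; omega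
        · intro a _ b _ hab
          have h0 := DFunLike.congr_fun hab 0
          have hne : Fin.last k ≠ 0 := by
            intro h; have := congrArg Fin.val h; simp at this; omega
          simpa [Finsupp.single_apply, hne] using h0
      simpa using this

/-! Sort monomials by their exponent at `x_1`. The slice `i` of `S₁ · M` is the union of `S'₁ · M^i`
and `M^{i-1}` (with the power of `x_1` removed), so Macaulay's bound in one variable less gives it
at least `max (d_i^{<n-2>}) d_{i-1}` elements. Replacing all slices by lexsegments of the same sizes
(compression, `lexAssemble`) attains this bound in every slice, because lexsegments of one degree
are nested.

By Macaulay's bound in all `n` variables, a Gotzmann set has the least growth among sets of its size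
and degree. Comparison with its compression forces equality in every slice, which is claim 1. If the
first term of the maximum dominates, then `S'₁ · M^i` has at most `d_i^{<n-2>}` elements, which is
claim 2. If claim 3 failed, moving one monomial from slice `i - 1` to slice `i` would give sizes
with a strictly smaller total growth.

Macaulay's bound (`macaulayBound`) is proved by induction on the number of variables. Among the sets
of given size and degree whose growth does not exceed that of the given set, take the colex-largest
one. It is compressed in every variable, and `isLexsegment_of_extremal` shows by exchange arguments
that it is lexsegment. -/

/-! ### Growth of lexsegment sets -/

theorem mulVars_empty {σ : Type*} [Fintype σ] [DecidableEq σ] :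
    mulVars (∅ : Finset (σ →₀ ℕ)) = ∅ := by
  simp [mulVars]

theorem mulVars_mono {σ : Type*} [Fintype σ] [DecidableEq σ] {M N : Finset (σ →₀ ℕ)}
    (h : M ⊆ N) : mulVars M ⊆ mulVars N :=
  Finset.biUnion_subset_biUnion_of_subset_left _ h

theorem degree_of_mem_mulVars {σ : Type*} [Fintype σ] [DecidableEq σ] {M : Finset (σ →₀ ℕ)}
    {t : ℕ} (hM : ∀ m ∈ M, m.degree = t) : ∀ m ∈ mulVars M, m.degree = t + 1 := by
  intro m hm
  obtain ⟨u, hu, j, rfl⟩ := mem_mulVars.1 hm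
  simp [hM u hu]

theorem card_mulVars_image_add {σ : Type*} [Fintype σ] [DecidableEq σ] (M : Finset (σ →₀ ℕ))
    (c : σ →₀ ℕ) : (mulVars (M.image (· + c))).card = (mulVars M).card := by
  rw [← Finset.card_image_of_injective (mulVars M) (add_left_injective c)]
  congr 1
  ext v
  simp only [mem_mulVars, mem_image]
  constructor
  · rintro ⟨_, ⟨m, hm, rfl⟩, j, rfl⟩
    exact ⟨_, ⟨m, hm, j, rfl⟩, add_right_comm _ _ _⟩
  · rintro ⟨_, ⟨m, hm, j, rfl⟩, rfl⟩
    exact ⟨_, ⟨m, hm, rfl⟩, j, add_right_comm _ _ _⟩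

theorem card_le_card_monomialsOfDegree {σ : Type*} [Fintype σ] [DecidableEq σ]
    {M : Finset (σ →₀ ℕ)} {t : ℕ} (hM : ∀ m ∈ M, m.degree = t) :
    M.card ≤ (monomialsOfDegree σ t).card :=
  Finset.card_le_card fun m hm => mem_monomialsOfDegree.2 (hM m hm)

theorem lexSegment_zero (σ : Type*) [Fintype σ] [LinearOrder σ] (t : ℕ) :
    lexSegment σ t 0 = ∅ := by
  simp [lexSegment]

theorem lexSegment_mono {σ : Type*} [Fintype σ] [LinearOrder σ] (t : ℕ) {d e : ℕ} (h : d ≤ e) :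
    lexSegment σ t d ⊆ lexSegment σ t e := by
  intro m hm
  simp only [lexSegment, mem_filter] at hm ⊢
  exact ⟨hm.1, hm.2.trans_le h⟩

theorem card_mulVars_lexSegment {k s d : ℕ} (hd : d ≤ (monomialsOfDegree (Fin (k + 1)) s).card) :
    (mulVars (lexSegment (Fin (k + 1)) s d)).card = lexGrowth k d := by
  have := card_mulVars_eq_lexGrowth (isLexsegment_lexSegment (Fin (k + 1)) s d)
    (fun m hm => degree_of_mem_lexSegment hm)
  rwa [card_lexSegment hd] at this

theorem lexGrowth_zero (k : ℕ) : lexGrowth k 0 = 0 := by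
  rw [← card_mulVars_lexSegment (s := 0) (Nat.zero_le _), lexSegment_zero, mulVars_empty, card_empty]

theorem lexGrowth_mono {k s d e : ℕ} (h : d ≤ e)
    (he : e ≤ (monomialsOfDegree (Fin (k + 1)) s).card) : lexGrowth k d ≤ lexGrowth k e := by
  rw [← card_mulVars_lexSegment he, ← card_mulVars_lexSegment (h.trans he)]
  exact Finset.card_le_card (mulVars_mono (lexSegment_mono s h))

theorem lexGrowth_le_card_monomialsOfDegree {k s d : ℕ}
    (hd : d ≤ (monomialsOfDegree (Fin (k + 1)) s).card) :
    lexGrowth k d ≤ (monomialsOfDegree (Fin (k + 1)) (s + 1)).card := by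
  rw [← card_mulVars_lexSegment hd]
  exact card_le_card_monomialsOfDegree
    (degree_of_mem_mulVars fun m hm => degree_of_mem_lexSegment hm)

/-- Two lexsegment sets of the same degree are nested. -/
theorem IsLexsegment.subset_or_subset {σ : Type*} [Fintype σ] [LinearOrder σ] {t : ℕ}
    {K L : Finset (σ →₀ ℕ)} (hK : IsLexsegment K) (hKt : ∀ m ∈ K, m.degree = t)
    (hL : IsLexsegment L) (hLt : ∀ m ∈ L, m.degree = t) : K ⊆ L ∨ L ⊆ K := by
  rw [hK.eq_lexSegment hKt, hL.eq_lexSegment hLt]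
  exact (le_total K.card L.card).imp (lexSegment_mono t) (lexSegment_mono t)

theorem IsLexsegment.card_union {σ : Type*} [Fintype σ] [LinearOrder σ] {t : ℕ}
    {K L : Finset (σ →₀ ℕ)} (hK : IsLexsegment K) (hKt : ∀ m ∈ K, m.degree = t)
    (hL : IsLexsegment L) (hLt : ∀ m ∈ L, m.degree = t) :
    (K ∪ L).card = max K.card L.card := by
  rcases hK.subset_or_subset hKt hL hLt with h | h
  · rw [Finset.union_eq_right.2 h, max_eq_right (Finset.card_le_card h)]
  · rw [Finset.union_eq_left.2 h, max_eq_left (Finset.card_le_card h)]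

/-- If `v` exceeds a product `m * x_j`, then `v` divided by its last variable is still at least `m`,
hence lies in `L`. -/
theorem isLexsegment_mulVars {σ : Type*} [Fintype σ] [LinearOrder σ] {L : Finset (σ →₀ ℕ)}
    (hL : IsLexsegment L) : IsLexsegment (mulVars L) := by
  intro y hy v hv hlt
  obtain ⟨m, hm, j, rfl⟩ := mem_mulVars.1 hy
  have hv0 : v.support.Nonempty := by
    rw [Finsupp.support_nonempty_iff]
    rintro rfl
    simp at hv
  obtain ⟨l, hlmem, hmax⟩ := v.support.exists_max_image id hv0
  have hle : Finsupp.single l 1 ≤ v := by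
    rw [Finsupp.single_le_iff]
    exact Nat.one_le_iff_ne_zero.2 (Finsupp.mem_support_iff.1 hlmem)
  obtain ⟨u, rfl⟩ : ∃ u, v = u + Finsupp.single l 1 := ⟨_, (tsub_add_cancel_of_le hle).symm⟩
  have hdeg : u.degree = m.degree := by simpa using hv
  refine mem_mulVars.2 ⟨u, ?_, l, rfl⟩
  rcases lt_trichotomy (toLex m) (toLex u) with h | h | h
  · exact hL m hm u hdeg h
  · rw [← toLex.injective h]; exact hm
  -- At the first difference `p` one has `u p < m p`. If `p < l`, then `v` would already be smaller
  -- than `m * x_j`. So `l ≤ p`, `u` vanishes beyond `p`, and its degree is too small.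
  · exfalso
    obtain ⟨p, hp1, hp2⟩ := Finsupp.Lex.lt_iff.1 h
    simp only [ofLex_toLex] at hp1 hp2
    have hlp : l ≤ p := by
      by_contra hlp
      rw [not_le] at hlp
      obtain ⟨q, hq1, hq2⟩ := Finsupp.Lex.lt_iff.1 hlt
      simp only [ofLex_toLex, Finsupp.add_apply, Finsupp.single_apply] at hq1 hq2
      rcases lt_trichotomy p q with h1 | h1 | h1
      · have := hq1 p h1
        rw [if_neg hlp.ne'] at this
        omega
      · subst h1
        rw [if_neg hlp.ne'] at hq2
        omega
      · have := hp1 q h1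
        rw [if_neg (h1.trans hlp).ne'] at hq2
        omega
    have hz : ∀ q, p < q → u q = 0 := by
      intro q hq
      by_contra hne
      have : q ≤ l := hmax q (by simp [hne])
      exact absurd hq (not_lt.2 (this.trans hlp))
    have : u.degree < m.degree := by
      rw [Finsupp.degree_eq_sum, Finsupp.degree_eq_sum]
      refine Finset.sum_lt_sum (fun q _ => ?_) ⟨p, mem_univ p, hp2⟩
      rcases lt_trichotomy p q with h1 | h1 | h1
      · rw [hz q h1]; exact Nat.zero_le _
      · rw [← h1]; exact hp2.le
      · rw [hp1 q h1]
    omega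

/-- Moving a factor from a later to an earlier variable increases a monomial. -/
theorem toLex_add_single_lt {σ : Type*} [LinearOrder σ] (m : σ →₀ ℕ) {i j : σ} (h : i < j) :
    toLex (m + Finsupp.single j 1) < toLex (m + Finsupp.single i 1) := by
  refine Finsupp.Lex.lt_iff.2 ⟨i, fun q hq => ?_, ?_⟩
  · simp [hq.ne', (hq.trans h).ne']
  · simp [h.ne']

/-! ### Slices with respect to a variable -/

section Slices

variable {n : ℕ}

/-- The monomial in `n + 1` variables with exponent `i` at `x_j` and the exponents of `m` at the
other variables. -/
noncomputable def insertVar (j : Fin (n + 1)) (i : ℕ) (m : Fin n →₀ ℕ) : Fin (n + 1) →₀ ℕ :=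
  Finsupp.equivFunOnFinite.symm (j.insertNth (α := fun _ => ℕ) i m)

/-- Forget the exponent of `x_j`. -/
noncomputable def removeVar (j : Fin (n + 1)) (m : Fin (n + 1) →₀ ℕ) : Fin n →₀ ℕ :=
  Finsupp.equivFunOnFinite.symm fun l => m (j.succAbove l)

@[simp] theorem insertVar_same (j : Fin (n + 1)) (i : ℕ) (m : Fin n →₀ ℕ) :
    insertVar j i m j = i := by
  simp [insertVar]

@[simp] theorem insertVar_succAbove (j : Fin (n + 1)) (i : ℕ) (m : Fin n →₀ ℕ) (l : Fin n) :
    insertVar j i m (j.succAbove l) = m l := by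
  simp [insertVar]

@[simp] theorem removeVar_apply (j : Fin (n + 1)) (m : Fin (n + 1) →₀ ℕ) (l : Fin n) :
    removeVar j m l = m (j.succAbove l) := rfl

theorem eq_insertVar_iff {j : Fin (n + 1)} {i : ℕ} {m : Fin n →₀ ℕ} {v : Fin (n + 1) →₀ ℕ} :
    v = insertVar j i m ↔ v j = i ∧ ∀ l, v (j.succAbove l) = m l := by
  constructor
  · rintro rfl; simp
  · rintro ⟨h1, h2⟩
    ext q
    rcases Fin.eq_self_or_eq_succAbove j q with rfl | ⟨l, rfl⟩
    · simp [h1]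
    · simp [h2]

@[simp] theorem insertVar_removeVar (j : Fin (n + 1)) (m : Fin (n + 1) →₀ ℕ) :
    insertVar j (m j) (removeVar j m) = m :=
  (eq_insertVar_iff.2 ⟨rfl, fun _ => rfl⟩).symm

@[simp] theorem removeVar_insertVar (j : Fin (n + 1)) (i : ℕ) (m : Fin n →₀ ℕ) :
    removeVar j (insertVar j i m) = m := by
  ext l; simp

theorem insertVar_injective (j : Fin (n + 1)) (i : ℕ) : Function.Injective (insertVar j i) :=
  fun a b h => by rw [← removeVar_insertVar j i a, h, removeVar_insertVar]

theorem insertVar_zero_eq_cons (i : ℕ) (m : Fin n →₀ ℕ) :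
    insertVar 0 i m = Finsupp.cons i m :=
  (eq_insertVar_iff.2 ⟨Finsupp.cons_zero _ _, fun l => by simp⟩).symm

theorem insertVar_add_single_same (j : Fin (n + 1)) (i : ℕ) (m : Fin n →₀ ℕ) :
    insertVar j i m + Finsupp.single j 1 = insertVar j (i + 1) m :=
  eq_insertVar_iff.2 ⟨by simp, fun l => by simp⟩

theorem insertVar_add_single_succAbove (j : Fin (n + 1)) (i : ℕ) (m : Fin n →₀ ℕ) (l : Fin n) :
    insertVar j i m + Finsupp.single (j.succAbove l) 1 =
      insertVar j i (m + Finsupp.single l 1) :=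
  eq_insertVar_iff.2 ⟨by simp,
    fun q => by simp [Finsupp.single_apply]⟩

theorem degree_insertVar (j : Fin (n + 1)) (i : ℕ) (m : Fin n →₀ ℕ) :
    (insertVar j i m).degree = i + m.degree := by
  simp [Finsupp.degree_eq_sum, Fin.sum_univ_succAbove _ j]

theorem toLex_insertVar_lt {j : Fin (n + 1)} {i : ℕ} {u v : Fin n →₀ ℕ} :
    toLex (insertVar j i u) < toLex (insertVar j i v) ↔ toLex u < toLex v := by
  have key : ∀ {u v : Fin n →₀ ℕ}, toLex u < toLex v →
      toLex (insertVar j i u) < toLex (insertVar j i v) := by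
    intro u v h
    obtain ⟨p, hp1, hp2⟩ := Finsupp.Lex.lt_iff.1 h
    refine Finsupp.Lex.lt_iff.2 ⟨j.succAbove p, fun q hq => ?_, by simpa using hp2⟩
    rcases Fin.eq_self_or_eq_succAbove j q with rfl | ⟨l, rfl⟩
    · simp
    · simpa using hp1 l ((Fin.strictMono_succAbove j).lt_iff_lt.1 hq)
  refine ⟨fun h => ?_, key⟩
  rcases lt_trichotomy (toLex u) (toLex v) with h1 | h1 | h1
  · exact h1
  · rw [toLex.injective h1] at h; exact absurd h (lt_irrefl _)
  · exact absurd h (key h1).asymm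

/-- The monomials `m` without `x_j` such that `x_j ^ i * m ∈ M`. -/
noncomputable def varSlice (j : Fin (n + 1)) (M : Finset (Fin (n + 1) →₀ ℕ)) (i : ℕ) : Finset (Fin n →₀ ℕ) :=
  (M.filter fun m => m j = i).image (removeVar j)

theorem mem_varSlice {j : Fin (n + 1)} {M : Finset (Fin (n + 1) →₀ ℕ)} {i : ℕ} {m : Fin n →₀ ℕ} :
    m ∈ varSlice j M i ↔ insertVar j i m ∈ M := by
  simp only [varSlice, mem_image, mem_filter]
  constructor
  · rintro ⟨a, ⟨ha, rfl⟩, rfl⟩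
    rwa [insertVar_removeVar]
  · intro h
    exact ⟨_, ⟨h, insertVar_same _ _ _⟩, removeVar_insertVar _ _ _⟩

theorem removeVar_mem_varSlice {j : Fin (n + 1)} {M : Finset (Fin (n + 1) →₀ ℕ)}
    {m : Fin (n + 1) →₀ ℕ} : removeVar j m ∈ varSlice j M (m j) ↔ m ∈ M := by
  rw [mem_varSlice, insertVar_removeVar]

theorem card_varSlice (j : Fin (n + 1)) (M : Finset (Fin (n + 1) →₀ ℕ)) (i : ℕ) :
    (varSlice j M i).card = (M.filter fun m => m j = i).card := by
  refine Finset.card_image_of_injOn ?_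
  intro a ha b hb h
  have ha' := (mem_filter.1 (Finset.mem_coe.1 ha)).2
  have hb' := (mem_filter.1 (Finset.mem_coe.1 hb)).2
  rw [← insertVar_removeVar j a, ← insertVar_removeVar j b, ha', hb', h]

theorem card_eq_sum_card_varSlice (j : Fin (n + 1)) {M : Finset (Fin (n + 1) →₀ ℕ)} {t : ℕ}
    (hM : ∀ m ∈ M, m.degree = t) : M.card = ∑ i ∈ range (t + 1), (varSlice j M i).card := by
  simp_rw [card_varSlice]
  refine Finset.card_eq_sum_card_fiberwise fun m hm => ?_
  have := Finsupp.le_degree j m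
  rw [hM m hm] at this
  exact Finset.mem_coe.2 (mem_range.2 (by omega))

theorem degree_add_of_mem_varSlice {j : Fin (n + 1)} {M : Finset (Fin (n + 1) →₀ ℕ)} {t i : ℕ}
    (hM : ∀ m ∈ M, m.degree = t) {m : Fin n →₀ ℕ} (hm : m ∈ varSlice j M i) : i + m.degree = t := by
  rw [← degree_insertVar j]
  exact hM _ (mem_varSlice.1 hm)

theorem varSlice_mulVars_zero (j : Fin (n + 1)) (M : Finset (Fin (n + 1) →₀ ℕ)) :
    varSlice j (mulVars M) 0 = mulVars (varSlice j M 0) := by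
  ext m
  simp only [mem_varSlice, mem_mulVars]
  constructor
  · rintro ⟨a, ha, q, hq⟩
    rcases Fin.eq_self_or_eq_succAbove j q with rfl | ⟨l, rfl⟩
    · have := DFunLike.congr_fun hq q
      simp at this
    · rw [← insertVar_removeVar j a, insertVar_add_single_succAbove] at hq
      have h0 : a j = 0 := by simpa using DFunLike.congr_fun hq j
      rw [h0] at hq
      refine ⟨removeVar j a, ?_, l, insertVar_injective _ _ hq⟩
      rwa [← h0, insertVar_removeVar]
  · rintro ⟨a, ha, l, rfl⟩
    exact ⟨_, ha, _, insertVar_add_single_succAbove _ _ _ _⟩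

theorem varSlice_mulVars_succ (j : Fin (n + 1)) (M : Finset (Fin (n + 1) →₀ ℕ)) (i : ℕ) :
    varSlice j (mulVars M) (i + 1) = mulVars (varSlice j M (i + 1)) ∪ varSlice j M i := by
  ext m
  simp only [mem_varSlice, mem_mulVars, mem_union]
  constructor
  · rintro ⟨a, ha, q, hq⟩
    rcases Fin.eq_self_or_eq_succAbove j q with rfl | ⟨l, rfl⟩
    · right
      rw [← insertVar_add_single_same] at hq
      rwa [← add_right_cancel hq]
    · left
      rw [← insertVar_removeVar j a, insertVar_add_single_succAbove] at hq
      have h0 : a j = i + 1 := by simpa using DFunLike.congr_fun hq j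
      rw [h0] at hq
      refine ⟨removeVar j a, ?_, l, insertVar_injective _ _ hq⟩
      rwa [← h0, insertVar_removeVar]
  · rintro (⟨a, ha, l, rfl⟩ | h)
    · exact ⟨_, ha, _, insertVar_add_single_succAbove _ _ _ _⟩
    · exact ⟨_, h, j, insertVar_add_single_same _ _ _⟩

end Slices

/-! ### Compression: sets with lexsegment slices -/

/-- The size of the `i`-th slice of `S₁ · M` when all slices of `M` are lexsegments, of sizes
`d i`. -/
noncomputable def sliceGrowth (k : ℕ) (d : ℕ → ℕ) : ℕ → ℕ
  | 0 => lexGrowth k (d 0)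
  | i + 1 => max (lexGrowth k (d (i + 1))) (d i)

/-- `d i` monomials of degree `t - i` in `k + 1` variables exist for all `i`. -/
def IsSliceSize (k t : ℕ) (d : ℕ → ℕ) : Prop :=
  (∀ i ≤ t, d i ≤ (monomialsOfDegree (Fin (k + 1)) (t - i)).card) ∧ ∀ i, t < i → d i = 0

/-- The set with lexsegment slices of sizes `d i`. -/
noncomputable def lexAssemble {k : ℕ} (j : Fin (k + 2)) (t : ℕ) (d : ℕ → ℕ) :
    Finset (Fin (k + 2) →₀ ℕ) :=
  (range (t + 1)).biUnion fun i => (lexSegment (Fin (k + 1)) (t - i) (d i)).image (insertVar j i)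

section

variable {k t : ℕ} {j : Fin (k + 2)} {d : ℕ → ℕ}

theorem isSliceSize_card_varSlice {M : Finset (Fin (k + 2) →₀ ℕ)} (hM : ∀ m ∈ M, m.degree = t) :
    IsSliceSize k t fun i => (varSlice j M i).card := by
  refine ⟨fun i hi => card_le_card_monomialsOfDegree fun m hm => ?_, fun i hi => ?_⟩
  · have := degree_add_of_mem_varSlice hM hm
    omega
  · refine Finset.card_eq_zero.2 (Finset.eq_empty_of_forall_notMem fun m hm => ?_)
    have := degree_add_of_mem_varSlice hM hm
    omega

theorem IsSliceSize.le_card (hd : IsSliceSize k t d) (i : ℕ) :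
    d i ≤ (monomialsOfDegree (Fin (k + 1)) (t - i)).card := by
  rcases le_or_gt i t with h | h
  · exact hd.1 i h
  · rw [hd.2 i h]; exact Nat.zero_le _

theorem varSlice_lexAssemble (hd : IsSliceSize k t d) (i : ℕ) :
    varSlice j (lexAssemble j t d) i = lexSegment (Fin (k + 1)) (t - i) (d i) := by
  ext m
  simp only [mem_varSlice, lexAssemble, mem_biUnion, mem_image, mem_range]
  constructor
  · rintro ⟨q, hq, a, ha, h⟩
    have h1 : q = i := by simpa using DFunLike.congr_fun h j
    subst h1
    rwa [← insertVar_injective _ _ h]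
  · intro hm
    refine ⟨i, ?_, m, hm, rfl⟩
    by_contra h
    rw [hd.2 i (by omega), lexSegment_zero] at hm
    simp at hm

theorem degree_of_mem_lexAssemble {m : Fin (k + 2) →₀ ℕ} (hm : m ∈ lexAssemble j t d) :
    m.degree = t := by
  simp only [lexAssemble, mem_biUnion, mem_image, mem_range] at hm
  obtain ⟨i, hi, a, ha, rfl⟩ := hm
  rw [degree_insertVar, degree_of_mem_lexSegment ha]
  omega

theorem card_varSlice_lexAssemble (hd : IsSliceSize k t d) (i : ℕ) :
    (varSlice j (lexAssemble j t d) i).card = d i := by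
  rw [varSlice_lexAssemble hd, card_lexSegment (hd.le_card i)]

theorem card_lexAssemble (hd : IsSliceSize k t d) :
    (lexAssemble j t d).card = ∑ i ∈ range (t + 1), d i := by
  rw [card_eq_sum_card_varSlice j fun m hm => degree_of_mem_lexAssemble hm]
  simp_rw [card_varSlice_lexAssemble hd]

/-- Both parts of the slice are lexsegments of the same degree, hence nested, so the size of their
union is the maximum of their sizes. -/
theorem card_varSlice_mulVars_lexAssemble (hd : IsSliceSize k t d) (i : ℕ) :
    (varSlice j (mulVars (lexAssemble j t d)) i).card = sliceGrowth k d i := by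
  rcases i with _ | i
  · rw [varSlice_mulVars_zero, varSlice_lexAssemble hd, card_mulVars_lexSegment (hd.le_card 0),
      sliceGrowth]
  · rw [varSlice_mulVars_succ, varSlice_lexAssemble hd, varSlice_lexAssemble hd, sliceGrowth]
    -- Beyond degree `t` the truncated subtraction `t - (i + 1)` no longer gives matching degrees,
    -- but there `d (i + 1) = 0` and only the second part remains.
    rcases le_or_gt (i + 1) t with h | h
    · rw [IsLexsegment.card_union (t := t - i)
        (isLexsegment_mulVars (isLexsegment_lexSegment _ _ _)) ?_
        (isLexsegment_lexSegment _ _ _) fun m hm => degree_of_mem_lexSegment hm,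
        card_mulVars_lexSegment (hd.le_card _), card_lexSegment (hd.le_card _)]
      have := degree_of_mem_mulVars
        fun m (hm : m ∈ lexSegment (Fin (k + 1)) (t - (i + 1)) (d (i + 1))) =>
          degree_of_mem_lexSegment hm
      rwa [show t - (i + 1) + 1 = t - i by omega] at this
    · rw [hd.2 _ h, lexSegment_zero, mulVars_empty, empty_union, lexGrowth_zero,
        card_lexSegment (hd.le_card _), Nat.zero_max]

theorem card_mulVars_lexAssemble (hd : IsSliceSize k t d) :
    (mulVars (lexAssemble j t d)).card = ∑ i ∈ range (t + 2), sliceGrowth k d i := by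
  rw [card_eq_sum_card_varSlice j
    (degree_of_mem_mulVars fun m hm => degree_of_mem_lexAssemble hm)]
  simp_rw [card_varSlice_mulVars_lexAssemble hd]

end

/-! ### Macaulay's bound -/

/-- Macaulay's bound in `k + 1` variables: lexsegment sets have the smallest growth. -/
def MacaulayBound (k : ℕ) : Prop :=
  ∀ (t : ℕ) (M : Finset (Fin (k + 1) →₀ ℕ)), (∀ m ∈ M, m.degree = t) →
    lexGrowth k M.card ≤ (mulVars M).card

theorem sliceGrowth_le_card_varSlice_mulVars {k t : ℕ} (hk : MacaulayBound k) (j : Fin (k + 2))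
    {M : Finset (Fin (k + 2) →₀ ℕ)} (hM : ∀ m ∈ M, m.degree = t) (i : ℕ) :
    sliceGrowth k (fun i => (varSlice j M i).card) i ≤ (varSlice j (mulVars M) i).card := by
  have key : ∀ i, lexGrowth k (varSlice j M i).card ≤ (mulVars (varSlice j M i)).card := fun i =>
    hk (t - i) _ fun m hm => by
      have := degree_add_of_mem_varSlice hM hm
      omega
  rcases i with _ | i
  · rw [varSlice_mulVars_zero, sliceGrowth]
    exact key 0
  · rw [varSlice_mulVars_succ, sliceGrowth]
    exact max_le ((key _).trans (Finset.card_le_card Finset.subset_union_left))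
      (Finset.card_le_card Finset.subset_union_right)

theorem sum_sliceGrowth_le_card_mulVars {k t : ℕ} (hk : MacaulayBound k) (j : Fin (k + 2))
    {M : Finset (Fin (k + 2) →₀ ℕ)} (hM : ∀ m ∈ M, m.degree = t) :
    ∑ i ∈ range (t + 2), sliceGrowth k (fun i => (varSlice j M i).card) i ≤ (mulVars M).card := by
  rw [card_eq_sum_card_varSlice j (degree_of_mem_mulVars hM)]
  exact Finset.sum_le_sum fun i _ => sliceGrowth_le_card_varSlice_mulVars hk j hM i

/-- The order on finite sets of monomials in which the largest monomial in the symmetric difference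
decides. -/
noncomputable def monomialColex {σ : Type*} [LinearOrder σ] (M : Finset (σ →₀ ℕ)) :
    Colex (Finset (Lex (σ →₀ ℕ))) :=
  toColex (M.map toLex.toEmbedding)

theorem monomialColex_lt {σ : Type*} [LinearOrder σ] {M N : Finset (σ →₀ ℕ)} {a : σ →₀ ℕ}
    (ha : a ∈ N) (haM : a ∉ M) (h : ∀ b ∈ M, b ∉ N → toLex b < toLex a) :
    monomialColex M < monomialColex N := by
  rw [monomialColex, monomialColex, Finset.Colex.toColex_lt_toColex_iff_exists_forall_lt]
  refine ⟨toLex a, by simpa using ha, by simpa using haM, fun b hb hbN => ?_⟩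
  obtain ⟨b, hb', rfl⟩ := Finset.mem_map.1 hb
  exact h b hb' fun hbN' => hbN (Finset.mem_map.2 ⟨b, hbN', rfl⟩)

/-- Compression increases a set in the colex order. -/
theorem monomialColex_lt_lexAssemble {k t : ℕ} (j : Fin (k + 2))
    {M : Finset (Fin (k + 2) →₀ ℕ)} (hM : ∀ m ∈ M, m.degree = t)
    (hne : lexAssemble j t (fun i => (varSlice j M i).card) ≠ M) :
    monomialColex M < monomialColex (lexAssemble j t (fun i => (varSlice j M i).card)) := by
  classical
  have hd := isSliceSize_card_varSlice (j := j) hM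
  set N := lexAssemble j t (fun i => (varSlice j M i).card) with hN
  have hcard : N.card = M.card := by
    rw [hN, card_lexAssemble hd, card_eq_sum_card_varSlice j hM]
  have hnon : (N \ M).Nonempty := by
    rw [Finset.sdiff_nonempty]
    exact fun h => hne (Finset.eq_of_subset_of_card_le h hcard.ge)
  obtain ⟨a, ha, hmax⟩ := (N \ M).exists_max_image toLex hnon
  rw [mem_sdiff] at ha
  refine monomialColex_lt ha.1 ha.2 fun b hb hbN => ?_
  set i := b j with hi
  have hb1 : removeVar j b ∈ varSlice j M i := removeVar_mem_varSlice.2 hb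
  have hb2 : removeVar j b ∉ varSlice j N i := fun h => hbN (removeVar_mem_varSlice.1 h)
  have hc : (varSlice j N i).card = (varSlice j M i).card := card_varSlice_lexAssemble hd i
  -- Slices keep their size, so the loss of `b` is matched by a gain `c` in the same slice. As the
  -- new slice is lexsegment, `c` is larger than the lost monomial.
  obtain ⟨c, hcN, hcM⟩ : ∃ c ∈ varSlice j N i, c ∉ varSlice j M i := by
    by_contra! h
    exact hb2 ((Finset.eq_of_subset_of_card_le h hc.ge).symm ▸ hb1)
  have hlt : toLex (removeVar j b) < toLex c := by
    by_contra hle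
    rcases lt_or_eq_of_le (not_lt.1 hle) with h | h
    · refine hb2 ?_
      rw [varSlice_lexAssemble hd] at hcN ⊢
      refine isLexsegment_lexSegment _ _ _ c hcN _ ?_ h
      have := degree_add_of_mem_varSlice hM hb1
      rw [degree_of_mem_lexSegment hcN]
      omega
    · rw [toLex.injective h] at hcM
      exact hcM hb1
  refine lt_of_lt_of_le ?_ (hmax (insertVar j i c) (mem_sdiff.2 ⟨mem_varSlice.1 hcN,
    fun h => hcM (mem_varSlice.2 h)⟩))
  rw [← toLex_insertVar_lt (j := j) (i := i), hi, insertVar_removeVar] at hlt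
  exact hlt

/-- In one variable there is one monomial of each degree, so every homogeneous set is lexsegment. -/
theorem macaulayBound_zero : MacaulayBound 0 := by
  intro t M hM
  refine (card_mulVars_eq_lexGrowth (t := t) ?_ hM).ge
  intro m hm v hv _
  suffices v = m by rwa [this]
  ext j
  rw [Finsupp.degree_eq_sum, Finsupp.degree_eq_sum, Fin.sum_univ_one, Fin.sum_univ_one] at hv
  rwa [show j = 0 from Subsingleton.elim (α := Fin 1) j 0]

theorem toLex_le_toLex_single_zero {k : ℕ} (m : Fin (k + 1) →₀ ℕ) :
    toLex m ≤ toLex (Finsupp.single 0 m.degree) := by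
  by_contra h
  obtain ⟨p, hp1, hp2⟩ := Finsupp.Lex.lt_iff.1 (not_le.1 h)
  simp only [ofLex_toLex] at hp1 hp2
  have : (Finsupp.single (0 : Fin (k + 1)) m.degree).degree < m.degree := by
    rw [Finsupp.degree_eq_sum, Finsupp.degree_eq_sum m]
    refine Finset.sum_lt_sum (fun q _ => ?_) ⟨p, mem_univ p, by rwa [← Finsupp.degree_eq_sum]⟩
    rw [← Finsupp.degree_eq_sum]
    rcases Fin.eq_zero_or_eq_succ q with rfl | ⟨q, rfl⟩
    · rcases (Fin.zero_le p).eq_or_lt with rfl | h0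
      · exact hp2.le
      · exact (hp1 0 h0).le
    · simp
  simp at this

theorem toLex_lt_of_apply_zero_lt {k : ℕ} {u v : Fin (k + 1) →₀ ℕ} (h : u 0 < v 0) :
    toLex u < toLex v :=
  Finsupp.Lex.lt_iff.2 ⟨0, fun q hq => absurd hq (Fin.not_lt_zero q), h⟩

theorem apply_zero_le_of_toLex_lt {k : ℕ} {u v : Fin (k + 1) →₀ ℕ} (h : toLex u < toLex v) :
    u 0 ≤ v 0 := by
  by_contra hlt
  exact absurd h (toLex_lt_of_apply_zero_lt (not_le.1 hlt)).asymm

theorem exists_eq_add_single {σ : Type*} {m : σ →₀ ℕ} {j : σ} (h : m j ≠ 0) :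
    ∃ u, m = u + Finsupp.single j 1 :=
  ⟨_, (tsub_add_cancel_of_le (Finsupp.single_le_iff.2 (Nat.one_le_iff_ne_zero.2 h))).symm⟩

/-- Replacing the smallest monomial of `M` by the largest one outside `M` does not increase the
growth if the latter is divisible by the last variable. -/
theorem card_mulVars_swap_le {n t : ℕ} {M : Finset (Fin (n + 1) →₀ ℕ)}
    {v w : Fin (n + 1) →₀ ℕ} (hvt : v.degree = t)
    (hvmax : ∀ u : Fin (n + 1) →₀ ℕ, u.degree = t → toLex v < toLex u → u ∈ M)
    (hw : w ∈ M) (hwmin : ∀ u ∈ M, toLex w ≤ toLex u) (hwv : toLex w < toLex v)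
    (hlast : v (Fin.last n) ≠ 0) :
    (mulVars (insert v (M.erase w))).card ≤ (mulVars M).card := by
  have hmem : w + Finsupp.single (Fin.last n) 1 ∈ mulVars M := mem_mulVars.2 ⟨w, hw, _, rfl⟩
  have hsub : mulVars (insert v (M.erase w)) ⊆
      insert (v + Finsupp.single (Fin.last n) 1)
        ((mulVars M).erase (w + Finsupp.single (Fin.last n) 1)) := by
    intro x hx
    obtain ⟨m, hm, q, rfl⟩ := mem_mulVars.1 hx
    rw [mem_insert, mem_erase]
    rcases mem_insert.1 hm with rfl | hm
    · rcases (Fin.le_last q).eq_or_lt with rfl | hq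
      · exact Or.inl rfl
      right
      -- With `v = u * x_n`, the product `v * x_q` equals `(u * x_q) * x_n`, and `u * x_q > v` is
      -- already in `M`. Thus only `v * x_n` can be new.
      obtain ⟨u, rfl⟩ := exists_eq_add_single hlast
      have hlt := toLex_add_single_lt u hq
      have hu := hvmax (u + Finsupp.single q 1) (by simpa using hvt) hlt
      rw [add_right_comm]
      refine ⟨fun h => ?_, mem_mulVars.2 ⟨_, hu, _, rfl⟩⟩
      rw [← add_right_cancel h] at hwv
      exact absurd hlt hwv.asymm
    -- The product `w * x_n` is lost: if `m * x_q = w * x_n` with `q` not last, then `m < w`,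
    -- against the minimality of `w`.
    · right
      rw [mem_erase] at hm
      refine ⟨fun h => ?_, mem_mulVars.2 ⟨_, hm.2, _, rfl⟩⟩
      rcases (Fin.le_last q).eq_or_lt with rfl | hq
      · exact hm.1 (add_right_cancel h)
      · have hlt := toLex_add_single_lt m hq
        rw [h] at hlt
        exact absurd (hwmin m hm.2)
          (not_le.2 (lt_of_add_lt_add_right (a := toLex (Finsupp.single (Fin.last n) 1)) hlt))
  have hpos := Finset.card_pos.2 ⟨_, hmem⟩
  calc _ ≤ _ := Finset.card_le_card hsub
    _ ≤ _ := Finset.card_insert_le _ _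
    _ = _ := by rw [Finset.card_erase_of_mem hmem]; omega

/-- In two variables, a set without the largest monomial can be moved up without changing its
growth. -/
theorem exists_monomialColex_lt_of_two_vars {t : ℕ} {M : Finset (Fin 2 →₀ ℕ)}
    (hM : ∀ m ∈ M, m.degree = t) (hne : M.Nonempty) (h1 : ∀ m ∈ M, m 1 ≠ 0) :
    ∃ N : Finset (Fin 2 →₀ ℕ), (∀ m ∈ N, m.degree = t) ∧ N.card = M.card ∧
      (mulVars N).card = (mulVars M).card ∧ monomialColex M < monomialColex N := by
  -- Write `M = x_2 * K` and pass to `x_1 * K`: both have the growth of `K`.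
  obtain ⟨K, rfl⟩ : ∃ K : Finset (Fin 2 →₀ ℕ), M = K.image (· + Finsupp.single 1 1) := by
    refine ⟨M.image (· - Finsupp.single 1 1), ?_⟩
    rw [Finset.image_image]
    refine (Finset.image_id.symm.trans (Finset.image_congr fun m hm => ?_))
    exact (tsub_add_cancel_of_le
      (Finsupp.single_le_iff.2 (Nat.one_le_iff_ne_zero.2 (h1 m hm)))).symm
  obtain ⟨c, hc, hmax⟩ := K.exists_max_image toLex (by simpa using hne)
  have hlt : toLex (c + Finsupp.single 1 1) < toLex (c + Finsupp.single 0 1) :=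
    toLex_add_single_lt c (by decide)
  have hlt' : ∀ b ∈ K.image (· + Finsupp.single 1 1), toLex b < toLex (c + Finsupp.single 0 1) := by
    intro b hb
    obtain ⟨b, hbK, rfl⟩ := mem_image.1 hb
    exact lt_of_le_of_lt (add_le_add_left (hmax b hbK) (toLex (Finsupp.single 1 1))) hlt
  refine ⟨K.image (· + Finsupp.single 0 1), ?_, ?_, ?_, ?_⟩
  · intro m hm
    obtain ⟨u, hu, rfl⟩ := mem_image.1 hm
    rw [← hM _ (mem_image_of_mem _ hu)]
    simp
  · rw [Finset.card_image_of_injective _ (add_left_injective _),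
      Finset.card_image_of_injective _ (add_left_injective _)]
  · rw [card_mulVars_image_add, card_mulVars_image_add]
  · exact monomialColex_lt (mem_image_of_mem _ hc) (fun h => lt_irrefl _ (hlt' _ h))
      fun b hb _ => hlt' b hb

/-- A set that is extremal for the growth and colex-largest is lexsegment. -/
theorem isLexsegment_of_extremal {k t : ℕ} (hk : MacaulayBound k)
    {M : Finset (Fin (k + 2) →₀ ℕ)} (hM : ∀ m ∈ M, m.degree = t)
    (hext : ∀ N : Finset (Fin (k + 2) →₀ ℕ), (∀ m ∈ N, m.degree = t) → N.card = M.card →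
      (mulVars N).card ≤ (mulVars M).card → ¬ monomialColex M < monomialColex N) :
    IsLexsegment M := by
  -- Extremality makes `M` equal to its compression in each variable `x_j`; hence `M` is closed
  -- upwards among monomials with the same exponent at `x_j`.
  have hcomp : ∀ j, ∀ m ∈ M, ∀ v : Fin (k + 2) →₀ ℕ, v.degree = t → toLex m < toLex v →
      v j = m j → v ∈ M := by
    intro j m hm v hv hlt hj
    have hd := isSliceSize_card_varSlice (j := j) hM
    have heq : lexAssemble j t (fun i => (varSlice j M i).card) = M := by
      by_contra hne
      refine hext _ (fun m hm => degree_of_mem_lexAssemble hm) ?_ ?_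
        (monomialColex_lt_lexAssemble j hM hne)
      · rw [card_lexAssemble hd, card_eq_sum_card_varSlice j hM]
      · rw [card_mulVars_lexAssemble hd]
        exact sum_sliceGrowth_le_card_mulVars hk j hM
    have hs := varSlice_lexAssemble (j := j) hd (m j)
    rw [heq] at hs
    rw [← removeVar_mem_varSlice (j := j), hj]
    have hm' := removeVar_mem_varSlice (j := j).2 hm
    rw [← insertVar_removeVar j m, ← insertVar_removeVar j v, hj, toLex_insertVar_lt] at hlt
    rw [hs] at hm' ⊢
    refine isLexsegment_lexSegment _ _ _ _ hm' _ ?_ hlt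
    have h1 := degree_insertVar j (m j) (removeVar j m)
    have h2 := degree_insertVar j (v j) (removeVar j v)
    rw [insertVar_removeVar, hM m hm] at h1
    rw [insertVar_removeVar, hv, hj] at h2
    omega
  intro m₀ hm₀ v₀ hv₀ hlt₀
  by_contra hv₀M
  obtain ⟨w, hw, hwmin⟩ := M.exists_min_image toLex ⟨m₀, hm₀⟩
  obtain ⟨v, hv, hvmax⟩ := (monomialsOfDegree (Fin (k + 2)) t \ M).exists_max_image toLex
    ⟨v₀, mem_sdiff.2 ⟨mem_monomialsOfDegree.2 (hv₀.trans (hM _ hm₀)), hv₀M⟩⟩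
  have hwv : toLex w < toLex v := ((hwmin _ hm₀).trans_lt hlt₀).trans_le
    (hvmax v₀ (mem_sdiff.2 ⟨mem_monomialsOfDegree.2 (hv₀.trans (hM _ hm₀)), hv₀M⟩))
  rw [mem_sdiff, mem_monomialsOfDegree] at hv
  obtain ⟨hvt, hvM⟩ := hv
  have hvmax' : ∀ u : Fin (k + 2) →₀ ℕ, u.degree = t → toLex v < toLex u → u ∈ M := by
    intro u hu hlt
    by_contra h
    exact absurd hlt (not_lt.2 (hvmax u (mem_sdiff.2 ⟨mem_monomialsOfDegree.2 hu, h⟩)))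
  by_cases hlast : v (Fin.last (k + 1)) = 0
  · rcases k with _ | k
    · have hl : Fin.last (0 + 1) = (1 : Fin 2) := rfl
      rw [hl] at hlast
      -- In two variables `v` is the power of `x_1`. Since it is not in `M`, every monomial of `M`
      -- is divisible by `x_2`.
      obtain ⟨N, hN1, hN2, hN3, hN4⟩ := exists_monomialColex_lt_of_two_vars hM ⟨w, hw⟩ (by
        intro m hm h1
        refine hvM ?_
        suffices v = m by rwa [this]
        have e1 := hM m hm
        rw [Finsupp.degree_eq_sum, Fin.sum_univ_two] at e1 hvt
        ext q
        fin_cases q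
        · change v 0 = m 0
          omega
        · change v 1 = m 1
          omega)
      exact hext N hN1 hN2 hN3.le hN4
    · have h0 : w 0 < v 0 := lt_of_le_of_ne (apply_zero_le_of_toLex_lt hwv)
        fun h => hvM (hcomp 0 w hw v hvt hwv h.symm)
      -- From `w` to `v` in two compressed steps: `u` moves all of `w` outside `x_1` onto `x_2`,
      -- keeping the exponent at `x_1`. With at least three variables `u` lacks the last variable,
      -- as does `v`, and `u < v` because `v` has the larger exponent at `x_1`.
      set u : Fin (k + 1 + 2) →₀ ℕ :=
        insertVar 0 (w 0) (Finsupp.single (0 : Fin (k + 1 + 1)) (removeVar 0 w).degree) with hu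
      have hut : u.degree = t := by
        rw [← hM w hw, ← insertVar_removeVar (0 : Fin (k + 1 + 2)) w, hu, degree_insertVar, degree_insertVar]
        simp
      have hu0 : u 0 = w 0 := insertVar_same _ _ _
      have huM : u ∈ M := by
        rcases (toLex_le_toLex_single_zero (removeVar 0 w)).eq_or_lt with h | h
        · rw [hu, ← toLex.injective h, insertVar_removeVar]
          exact hw
        · rw [← toLex_insertVar_lt (j := 0) (i := w 0), insertVar_removeVar] at h
          exact hcomp 0 w hw u hut h hu0
      have hul : u (Fin.last (k + 1 + 1)) = 0 := by
        have : Fin.last (k + 1 + 1) = (0 : Fin (k + 1 + 2)).succAbove (Fin.last (k + 1)) := by simp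
        rw [this, hu, insertVar_succAbove]
        simp [Fin.ext_iff]
      exact hvM (hcomp (Fin.last _) u huM v hvt (toLex_lt_of_apply_zero_lt (hu0 ▸ h0))
        (hlast.trans hul.symm))
  · refine hext (insert v (M.erase w)) ?_ ?_
      (card_mulVars_swap_le hvt hvmax' hw hwmin hwv hlast) ?_
    · intro m hm
      rcases mem_insert.1 hm with rfl | hm
      · exact hvt
      · exact hM m (mem_of_mem_erase hm)
    · rw [Finset.card_insert_of_notMem fun h => hvM (mem_of_mem_erase h),
        Finset.card_erase_add_one hw]
    · refine monomialColex_lt (mem_insert_self _ _) hvM fun b hb hbN => ?_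
      have : b = w := by
        by_contra h
        exact hbN (mem_insert_of_mem (mem_erase.2 ⟨h, hb⟩))
      rwa [this]

theorem macaulayBound_succ {k : ℕ} (hk : MacaulayBound k) : MacaulayBound (k + 1) := by
  intro t M₀ hM₀
  set C := ((monomialsOfDegree (Fin (k + 2)) t).powersetCard M₀.card).filter
    fun N => (mulVars N).card ≤ (mulVars M₀).card with hC
  have hmemC : ∀ N, N ∈ C ↔ ((∀ m ∈ N, m.degree = t) ∧ N.card = M₀.card) ∧
      (mulVars N).card ≤ (mulVars M₀).card := by
    intro N
    rw [hC, mem_filter, mem_powersetCard]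
    simp only [Finset.subset_iff, mem_monomialsOfDegree]
  obtain ⟨M, hMC, hmax⟩ := C.exists_max_image monomialColex
    ⟨M₀, (hmemC _).2 ⟨⟨hM₀, rfl⟩, le_rfl⟩⟩
  obtain ⟨⟨hM, hc⟩, hle⟩ := (hmemC M).1 hMC
  have hlex := isLexsegment_of_extremal hk hM fun N h1 h2 h3 =>
    not_lt.2 (hmax N ((hmemC N).2 ⟨⟨h1, h2.trans hc⟩, h3.trans hle⟩))
  rw [← hc, ← card_mulVars_eq_lexGrowth hlex hM]
  exact hle

theorem macaulayBound (k : ℕ) : MacaulayBound k := by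
  induction k with
  | zero => exact macaulayBound_zero
  | succ k ih => exact macaulayBound_succ ih
-- Slices of Gotzmann sets
theorem IsGotzmann.card_mulVars {k : ℕ} {M : Finset (Fin (k + 1) →₀ ℕ)} (hM : IsGotzmann M) :
    (mulVars M).card = lexGrowth k M.card := by
  obtain ⟨t, ht, h⟩ := hM
  rw [← h, card_mulVars_lexSegment (card_le_card_monomialsOfDegree ht)]

theorem isGotzmann_of_card_mulVars_le {k t : ℕ} {M : Finset (Fin (k + 1) →₀ ℕ)}
    (hM : ∀ m ∈ M, m.degree = t) (h : (mulVars M).card ≤ lexGrowth k M.card) : IsGotzmann M := by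
  refine ⟨t, hM, ?_⟩
  rw [card_mulVars_lexSegment (card_le_card_monomialsOfDegree hM)]
  exact le_antisymm (macaulayBound k t M hM) h

theorem componentQuot_eq_varSlice {n : ℕ} (M : Finset (Fin (n + 1) →₀ ℕ)) (i : ℕ) :
    componentQuot M i = varSlice 0 M i := by
  ext m
  rw [mem_componentQuot, mem_varSlice, insertVar_zero_eq_cons]

theorem card_component {n : ℕ} (M : Finset (Fin (n + 1) →₀ ℕ)) (i : ℕ) :
    (component M i).card = (varSlice 0 M i).card := by
  rw [card_varSlice, component]
  simp only [Nat.cast_inj]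

theorem component_of_neg {n : ℕ} (M : Finset (Fin (n + 1) →₀ ℕ)) {i : ℤ} (hi : i < 0) :
    component M i = ∅ := by
  refine Finset.filter_eq_empty_iff.2 fun m _ h => ?_
  omega

section

variable {k t : ℕ} {M : Finset (Fin (k + 2) →₀ ℕ)}

/-- A Gotzmann set has the smallest growth among all the sets with lexsegment slices. -/
theorem IsGotzmann.card_mulVars_le_sum_sliceGrowth (hM : IsGotzmann M) {d : ℕ → ℕ}
    (hd : IsSliceSize k t d) (hsum : ∑ i ∈ range (t + 1), d i = M.card) :
    (mulVars M).card ≤ ∑ i ∈ range (t + 2), sliceGrowth k d i := by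
  rw [hM.card_mulVars, ← hsum, ← card_lexAssemble (j := 0) hd,
    ← card_mulVars_lexAssemble (j := 0) hd]
  exact macaulayBound (k + 1) t _ fun m hm => degree_of_mem_lexAssemble hm

/-- The slicewise lower bounds add up to the growth of the compression, which a Gotzmann set cannot
exceed; so each of them is an equality. -/
theorem IsGotzmann.card_varSlice_mulVars (hM : IsGotzmann M) (hMt : ∀ m ∈ M, m.degree = t)
    (j : Fin (k + 2)) {i : ℕ} (hi : i ≤ t + 1) :
    (varSlice j (mulVars M) i).card = sliceGrowth k (fun i => (varSlice j M i).card) i := by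
  have hle := hM.card_mulVars_le_sum_sliceGrowth (isSliceSize_card_varSlice (j := j) hMt)
    (card_eq_sum_card_varSlice j hMt).symm
  rw [card_eq_sum_card_varSlice j (degree_of_mem_mulVars hMt)] at hle
  have hpt := fun i (_ : i ∈ range (t + 2)) =>
    sliceGrowth_le_card_varSlice_mulVars (macaulayBound k) j hMt i
  exact ((Finset.sum_eq_sum_iff_of_le hpt).1 (le_antisymm (Finset.sum_le_sum hpt) hle) i
    (mem_range.2 (by omega))).symm

theorem IsGotzmann.isGotzmann_varSlice (hM : IsGotzmann M) (hMt : ∀ m ∈ M, m.degree = t)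
    (j : Fin (k + 2)) {i : ℕ} (hi : i ≤ t + 1)
    (h : sliceGrowth k (fun i => (varSlice j M i).card) i ≤ lexGrowth k (varSlice j M i).card) :
    IsGotzmann (varSlice j M i) := by
  refine isGotzmann_of_card_mulVars_le (t := t - i) (fun m hm => ?_) ?_
  · have := degree_add_of_mem_varSlice hMt hm
    omega
  · refine le_trans (Finset.card_le_card ?_) ((hM.card_varSlice_mulVars hMt j hi).trans_le h)
    rcases i with _ | i
    · rw [varSlice_mulVars_zero]
    · rw [varSlice_mulVars_succ]
      exact subset_union_left

/-- Moving one unit from the size of the slice `i` to the size of the slice `i + 1`. -/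
theorem IsGotzmann.growth_of_lt (hM : IsGotzmann M) (hMt : ∀ m ∈ M, m.degree = t)
    (j : Fin (k + 2)) {d : ℕ → ℕ} (hd : ∀ i, d i = (varSlice j M i).card) {i : ℕ}
    (h : lexGrowth k (d (i + 1)) < d i) :
    d i - 1 < lexGrowth k (d (i + 1) + 1) ∨ lexGrowth k (d (i + 2)) < d (i + 1) + 1 := by
  by_contra! hcon
  obtain ⟨h1, h2⟩ := hcon
  have hds : IsSliceSize k t d := by
    rw [funext hd]; exact isSliceSize_card_varSlice hMt
  -- The negated conclusion makes slice `i + 2` nonempty.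
  have hit : i + 2 ≤ t := by
    by_contra hlt
    rw [hds.2 (i + 2) (by omega), lexGrowth_zero] at h2
    omega
  set e : ℕ → ℕ := fun r => if r = i then d i - 1 else if r = i + 1 then d (i + 1) + 1 else d r
    with he
  have hei : e i = d i - 1 := by simp [he]
  have hei1 : e (i + 1) = d (i + 1) + 1 := by simp [he]
  have her : ∀ r, r ≠ i → r ≠ i + 1 → e r = d r := fun r a b => by simp [he, a, b]
  have hes : IsSliceSize k t e := by
    refine ⟨fun r hr => ?_, fun r hr => ?_⟩
    · by_cases a : r = i
      · rw [a, hei]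
        exact (Nat.sub_le _ _).trans (hds.le_card i)
      by_cases b : r = i + 1
      · rw [b, hei1]
        -- There is room for one more monomial in slice `i + 1`, since the growth of slice `i + 2`
        -- fits into that degree.
        refine h2.trans ?_
        have := lexGrowth_le_card_monomialsOfDegree (hds.le_card (i + 2))
        rwa [show t - (i + 2) + 1 = t - (i + 1) by omega] at this
      · rw [her r a b]
        exact hds.le_card r
    · rw [her r (by omega) (by omega)]
      exact hds.2 r hr
  have hsum : ∑ r ∈ range (t + 1), e r = M.card := by
    rw [card_eq_sum_card_varSlice j hMt]
    simp_rw [← hd]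
    -- Adding indicators to both sides avoids the truncated subtraction in `d i - 1`; here `d i` is
    -- positive by `h`.
    have key : ∑ r ∈ range (t + 1), (e r + if r = i then 1 else 0) =
        ∑ r ∈ range (t + 1), (d r + if r = i + 1 then 1 else 0) := by
      refine Finset.sum_congr rfl fun r _ => ?_
      by_cases a : r = i
      · subst a
        simp only [hei, if_true]
        rw [if_neg (by omega)]
        omega
      by_cases b : r = i + 1
      · subst b
        simp [hei1]
      · simp [her r a b, a, b]
    rw [Finset.sum_add_distrib, Finset.sum_add_distrib, Finset.sum_ite_eq', Finset.sum_ite_eq',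
      if_pos (mem_range.2 (by omega)), if_pos (mem_range.2 (by omega))] at key
    omega
  have hle := hM.card_mulVars_le_sum_sliceGrowth hes hsum
  have hge := sum_sliceGrowth_le_card_mulVars (macaulayBound k) j hMt
  simp_rw [← hd] at hge
  -- Only the terms `i`, `i + 1`, `i + 2` can change. The first does not grow, by monotonicity; the
  -- second drops from `d i` to `d i - 1`, by `h` and `h1`; the third does not grow, since `h2` lets
  -- the lexsegment growth absorb the extra unit.
  refine absurd (hge.trans hle) (not_le.2 (Finset.sum_lt_sum (fun r _ => ?_)
    ⟨i + 1, mem_range.2 (by omega), ?_⟩))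
  · have hmono : lexGrowth k (d i - 1) ≤ lexGrowth k (d i) :=
      lexGrowth_mono (Nat.sub_le _ _) (hds.le_card i)
    rcases r with _ | r
    · simp only [sliceGrowth]
      by_cases a : 0 = i
      · rw [a, hei]; exact hmono
      · rw [her 0 a (by omega)]
    · simp only [sliceGrowth]
      by_cases a : r + 1 = i
      · rw [a, hei, her r (by omega) (by omega)]
        exact max_le_max hmono le_rfl
      by_cases b : r = i
      · rw [b, hei, hei1]
        omega
      by_cases c : r = i + 1
      · rw [c, hei1, her (i + 1 + 1) (by omega) (by omega)]
        exact max_le (le_max_left _ _) (h2.trans (le_max_left _ _))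
      · rw [her r b c, her (r + 1) a (by omega)]
  · simp only [sliceGrowth, hei, hei1]
    omega

end

/-- The polynomial ring `S` has `n = k + 2` variables, so `n - 2 = k`, and `d i = |M^i|`. -/
theorem mainTheorem2 (k t : ℕ) (M : Finset (Fin (k + 2) →₀ ℕ))
    (hMt : ∀ m ∈ M, m.degree = t) (hM : IsGotzmann M)
    (d : ℤ → ℕ) (hd : ∀ i : ℤ, d i = (component M i).card)
    (i : ℤ) (hi0 : 0 ≤ i) (hit : i ≤ (t : ℤ) + 1) :
    (component (mulVars M) i).card = max (lexGrowth k (d i)) (d (i - 1)) ∧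
    (d (i - 1) ≤ lexGrowth k (d i) → IsGotzmann (componentQuot M i)) ∧
    (lexGrowth k (d i) < d (i - 1) →
      ((d (i - 1) : ℤ) - 1 < (lexGrowth k (d i + 1) : ℤ) ∨
        lexGrowth k (d (i + 1)) < d i + 1)) := by
  lift i to ℕ using hi0
  have hit' : i ≤ t + 1 := by omega
  have hdn : ∀ r : ℕ, d r = (varSlice 0 M r).card := fun r => by rw [hd, card_component]
  have hgrowth : sliceGrowth k (fun i => (varSlice 0 M i).card) i =
      max (lexGrowth k (d i)) (d ((i : ℤ) - 1)) := by
    rcases i with _ | i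
    · rw [hd (((0 : ℕ) : ℤ) - 1), component_of_neg _ (by simp), card_empty, hdn, sliceGrowth,
        Nat.max_zero]
    · rw [show ((i + 1 : ℕ) : ℤ) - 1 = (i : ℕ) by push_cast; ring, hdn, hdn, sliceGrowth]
  refine ⟨?_, fun h => ?_, fun h => ?_⟩
  · rw [card_component, hM.card_varSlice_mulVars hMt 0 hit', hgrowth]
  · rw [componentQuot_eq_varSlice]
    refine hM.isGotzmann_varSlice hMt 0 hit' ?_
    rw [hgrowth, max_eq_left h, hdn]
  · rcases i with _ | i
    -- For `i = 0` the slice of index `-1` is empty, so the hypothesis of claim 3 is impossible.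
    · rw [hd (((0 : ℕ) : ℤ) - 1), component_of_neg _ (by simp), card_empty] at h
      exact absurd h (Nat.not_lt_zero _)
    · have e1 : ((i + 1 : ℕ) : ℤ) - 1 = (i : ℕ) := by push_cast; ring
      have e2 : ((i + 1 : ℕ) : ℤ) + 1 = (i + 2 : ℕ) := by push_cast; ring
      rw [e1] at h ⊢
      rw [e2]
      rcases hM.growth_of_lt hMt 0 (d := fun r : ℕ => d r) hdn h with h' | h'
      · left
        omega
      · exact Or.inr h'
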